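/- For $\alpha\in\mathbb R$ let $\mu^{\rm osc}(\alpha)$ be the ground state energy of the shifted harmonic oscillator $-\partial_t^2+(t+\alpha)^2$ on $L^2(\mathbb R^+)$ with Neumann boundary condition at $t=0$, that is, the infimum of $\int_0^\infty \big(|u'|^2+(t+\alpha)^2u^2\big)\,dt$ over $u\in H^1(\mathbb R^+)$ with $t\,u\in L^2(\mathbb R^+)$ and $\int_0^\infty u^2\,dt=1$, and let $\Theta_0:=\inf_{\alpha\in\mathbb R}\mu^{\rm osc}(\alpha)$. For $b>0$, $\alpha\in\mathbb R$ and real-valued $f\in H^1(\mathbb R^+)$ let $$\mathcal E^{\rm 1D}_{0,\alpha}[f]:=\int_0^{\infty}\Big\{|f'(t)|^2+(t+\alpha)^2f(t)^2-\tfrac1{2b}\big(2f(t)^2-f(t)^4\big)\Big\}\,dt ,$$ which is $+\infty$ if $t f\notin L^2(\mathbb R^+)$. **Proposition 3.1 (positivity of the cost function in the half-plane case).** Let $1\le b<\Theta_0^{-1}$ and let $(f_0,\alpha_0)$, with $f_0\in H^1(\mathbb R^+)$ (taken as its continuous representative on $[0,\infty)$) and $\alpha_0\in\mathbb R$, be any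 pair minimizing $\mathcal E^{\rm 1D}_{0,\alpha}[f]$ jointly over all $f\in H^1(\mathbb R^+)$ and all $\alpha\in\mathbb R$. Then the cost function $$K_0(t):=f_0(t)^2+2\int_0^t(\eta+\alpha_0)\,f_0(\eta)^2\,d\eta$$ satisfies $K_0(t)\ge 0$ for every $t\ge 0$. -/

import Mathlib

open MeasureTheory Set
open scoped ContDiff

noncomputable section

namespace HalfLineGL

/-- Lebesgue measure on the open half-line `(0, ∞)`. -/
def halfLine : Measure ℝ := volume.restrict (Ioi 0)

/-- `g` is a weak derivative of `f` on `(0, ∞)`: integration by parts holds against every smooth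
test function with compact support contained in the open half-line. -/
def IsWeakDeriv (f g : ℝ → ℝ) : Prop :=
  ∀ φ : ℝ → ℝ, ContDiff ℝ ∞ φ → HasCompactSupport φ → tsupport φ ⊆ Ioi 0 →
    ∫ t, f t * deriv φ t ∂halfLine = - ∫ t, g t * φ t ∂halfLine

/-- `f` belongs to the Sobolev space `H¹(ℝ⁺)` and `g` is its weak derivative. -/
structure MemH1 (f g : ℝ → ℝ) : Prop where
  memLp : MemLp f 2 halfLine
  memLp_deriv : MemLp g 2 halfLine
  isWeakDeriv : IsWeakDeriv f g

/-- `f` belongs to `H¹(ℝ⁺)` with weak derivative `g`, and has finite energy. As `H¹(ℝ⁺)` is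
contained in `L² ∩ L⁴`, an `f ∈ H¹(ℝ⁺)` has finite energy (for one, equivalently for every,
shift `α`) exactly when `t f(t)` is square integrable; otherwise its energy is `+∞`. -/
structure FiniteEnergy (f g : ℝ → ℝ) : Prop extends MemH1 f g where
  memLp_mul : MemLp (fun t => t * f t) 2 halfLine

/-- The one-dimensional functional
`∫₀^∞ |f'|² + (t + α)² f² - (1 / 2b) (2 f² - f⁴) dt`, where `g` stands for `f'`. -/
def energy (b α : ℝ) (f g : ℝ → ℝ) : ℝ :=
  ∫ t, ((g t) ^ 2 + (t + α) ^ 2 * (f t) ^ 2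
    - 1 / (2 * b) * (2 * (f t) ^ 2 - (f t) ^ 4)) ∂halfLine

/-- `(f₀, α₀)` minimizes the one-dimensional functional jointly over all functions of `H¹(ℝ⁺)`
and all real shifts. (Functions of infinite energy cannot compete, the energy of `0` being `0`.)
The function `f₀` is the continuous representative of its class, so that it has pointwise values. -/
def IsMinimizingPair (b : ℝ) (f₀ : ℝ → ℝ) (α₀ : ℝ) : Prop :=
  ContinuousOn f₀ (Ici 0) ∧
  ∃ g₀ : ℝ → ℝ, FiniteEnergy f₀ g₀ ∧
    ∀ (α : ℝ) (f g : ℝ → ℝ), FiniteEnergy f g → energy b α₀ f₀ g₀ ≤ energy b α f g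

/-- The quadratic form `∫₀^∞ |u'|² + (t + α)² u² dt` of the Neumann realization of the shifted
harmonic oscillator `-∂ₜ² + (t + α)²` on the half-line, where `v` stands for `u'`. -/
def oscForm (α : ℝ) (u v : ℝ → ℝ) : ℝ :=
  ∫ t, ((v t) ^ 2 + (t + α) ^ 2 * (u t) ^ 2) ∂halfLine

/-- The ground state energy of the shifted harmonic oscillator on the half-line with Neumann
boundary condition: the infimum of its quadratic form over normalized functions. -/
def muOsc (α : ℝ) : ℝ :=
  sInf {e : ℝ | ∃ u v : ℝ → ℝ, FiniteEnergy u v ∧ ∫ t, (u t) ^ 2 ∂halfLine = 1 ∧ e = oscForm α u v}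

/-- The constant `Θ₀`, the least ground state energy over all shifts. -/
def theta0 : ℝ := ⨅ α : ℝ, muOsc α

/-- The cost function `K₀(t) = f₀²(t) + 2 ∫₀ᵗ (η + α₀) f₀²(η) dη`. -/
def costK0 (f₀ : ℝ → ℝ) (α₀ t : ℝ) : ℝ :=
  (f₀ t) ^ 2 + 2 * ∫ η in (0 : ℝ)..t, (η + α₀) * (f₀ η) ^ 2

end HalfLineGL

end

open Filter Topology

namespace HalfLineGL

/-! The cost function sees only `f₀ ^ 2`, and `|f₀|` is again a minimizer
(`IsMinimizingPair.exists_nonneg`), so let `f ≥ 0`. Varying `f` gives `f'' = (t + α)² f - (f - f³) /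
b` on `(0, ∞)` (`exists_hasDerivAt_of_minimal`); varying the shift gives `∫ (t + α) f² = 0`
(`integral_shift_mul_sq_eq_zero`). By the equation, `F(t) = 2 ∫₀ᵗ (η + α) f²` and `R = (t + α)² f² -
(2f² - f⁴) / (2b) - f'²` have the same derivative. At infinity `F → 0` by optimality of the shift,
so `R` converges; being integrable, it tends to `0`. Hence `F = R`
(`two_mul_integral_shift_mul_sq_eq`), and no boundary condition at `0` is needed.

Now `K = f² + F` satisfies `K(0) ≥ 0` and `K ≥ F → 0`, so a negative value would force a negative
interior minimum `s`. There `0 = K' = 2f (f' + (s + α) f)`, which gives `f'² = (s + α)² f²`: if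
`f(s) = 0`, then `f'(s) = 0` because `f ≥ 0`. Inserting this in `F = R` leaves `K(s) = (1 - 1/b) f²
+ f⁴ / (2b) ≥ 0` for `b ≥ 1`, a contradiction (`costK0_nonneg_of_nonneg`). -/

/-! ### Local integrability and weak derivatives on the half-line. -/

theorem intervalIntegrable_of_locallyIntegrable {u : ℝ → ℝ} (hu : LocallyIntegrable u halfLine)
    {T : ℝ} (hT : 0 ≤ T) : IntervalIntegrable u volume 0 T := by
  have h := hu.integrableOn_isCompact (isCompact_Icc (a := (0 : ℝ)) (b := T))
  rw [intervalIntegrable_iff_integrableOn_Ioc_of_le hT]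
  have h' := h.mono_set (Ioc_subset_Icc_self)
  unfold IntegrableOn halfLine at h'
  rw [Measure.restrict_restrict measurableSet_Ioc] at h'
  rwa [inter_eq_left.2 (fun x hx => hx.1)] at h'

theorem locallyIntegrable_halfLine_of_continuousOn {u : ℝ → ℝ} (hu : ContinuousOn u (Ici 0)) :
    LocallyIntegrable u halfLine := by
  have h : LocallyIntegrableOn u (Ici 0) volume := hu.locallyIntegrableOn measurableSet_Ici
  rw [locallyIntegrableOn_iff_locallyIntegrable_restrict isClosed_Ici] at h
  unfold halfLine
  intro x
  obtain ⟨s, hs, hs'⟩ := h x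
  exact ⟨s, hs, hs'.mono_measure (Measure.restrict_mono Ioi_subset_Ici_self le_rfl)⟩

theorem memLp_two_locallyIntegrable {u : ℝ → ℝ} (hu : MemLp u 2 halfLine) :
    LocallyIntegrable u halfLine := by
  unfold halfLine at *
  exact hu.locallyIntegrable (by norm_num)

theorem integrable_mul_of_hasCompactSupport {u φ : ℝ → ℝ} (hu : LocallyIntegrable u halfLine)
    (hφ : Continuous φ) (hφc : HasCompactSupport φ) :
    Integrable (fun t => u t * φ t) halfLine := by
  have := hu.integrable_smul_left_of_hasCompactSupport hφ hφc
  simpa [smul_eq_mul, mul_comm] using this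

/-- A compactly supported function on the open half-line vanishes off some `[a, T]`, `0 < a < T`. -/
theorem exists_Icc_of_tsupport_subset {φ : ℝ → ℝ} (hc : HasCompactSupport φ)
    (hs : tsupport φ ⊆ Ioi 0) : ∃ a T : ℝ, 0 < a ∧ a < T ∧ tsupport φ ⊆ Icc a T := by
  rcases (tsupport φ).eq_empty_or_nonempty with h | h
  · exact ⟨1, 2, by norm_num, by norm_num, by simp [h]⟩
  · obtain ⟨a, ha, hamin⟩ := hc.isCompact.exists_isLeast h
    obtain ⟨T, hT, hTmax⟩ := hc.isCompact.exists_isGreatest h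
    exact ⟨a, T + 1, hs ha, by linarith [hamin hT], fun x hx =>
      ⟨hamin hx, by linarith [hTmax hx]⟩⟩

theorem integral_halfLine_eq_intervalIntegral {F : ℝ → ℝ} {T : ℝ} (hT : 0 ≤ T)
    (h : ∀ t, T < t → F t = 0) : ∫ t, F t ∂halfLine = ∫ t in (0 : ℝ)..T, F t := by
  unfold halfLine
  rw [intervalIntegral.integral_of_le hT]
  refine setIntegral_eq_of_subset_of_forall_sdiff_eq_zero measurableSet_Ioi
    (fun x hx => hx.1) ?_
  intro x hx
  apply h
  by_contra hcon
  exact hx.2 ⟨hx.1, not_lt.1 hcon⟩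

/-- A locally absolutely continuous function has its a.e. derivative as weak derivative. -/
theorem isWeakDeriv_of_absolutelyContinuous {h g : ℝ → ℝ}
    (hac : ∀ T, 0 ≤ T → AbsolutelyContinuousOnInterval h 0 T)
    (hd : ∀ᵐ t ∂halfLine, deriv h t = g t) : IsWeakDeriv h g := by
  intro φ hφ hc hs
  obtain ⟨a, T, ha, haT, hsub⟩ := exists_Icc_of_tsupport_subset hc hs
  have hz : ∀ t, t ∉ Icc a T → φ t = 0 := fun t ht =>
    image_eq_zero_of_notMem_tsupport fun hh => ht (hsub hh)
  have hz' : ∀ t, t ∉ Icc a T → deriv φ t = 0 := fun t ht =>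
    image_eq_zero_of_notMem_tsupport fun hh => ht (hsub (tsupport_deriv_subset hh))
  -- `φ` may be nonzero on all of `(a, T)`; integrating up to `T + 1` puts both endpoints off `[a,
  -- T]`, so the boundary terms vanish.
  have hT1 : 0 ≤ T + 1 := by linarith
  have hφac : AbsolutelyContinuousOnInterval φ 0 (T + 1) :=
    (hφ.of_le (by norm_cast)).contDiffOn.absolutelyContinuousOnInterval
  rw [integral_halfLine_eq_intervalIntegral hT1 fun t ht => by
      rw [hz' t (fun h => by linarith [h.2]), mul_zero],
    integral_halfLine_eq_intervalIntegral hT1 fun t ht => by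
      rw [hz t (fun h => by linarith [h.2]), mul_zero],
    (hac (T + 1) hT1).integral_mul_deriv_eq_deriv_mul hφac,
    hz 0 (fun h => by linarith [h.1]), hz (T + 1) (fun h => by linarith [h.2])]
  simp only [mul_zero, sub_zero, zero_sub, neg_inj]
  apply intervalIntegral.integral_congr_ae
  unfold halfLine at hd
  rw [ae_restrict_iff' measurableSet_Ioi] at hd
  filter_upwards [hd] with t ht hmem
  rw [uIoc_of_le hT1] at hmem
  rw [ht hmem.1]

theorem IsWeakDeriv.sub {u₁ g₁ u₂ g₂ : ℝ → ℝ} (h₁ : IsWeakDeriv u₁ g₁) (h₂ : IsWeakDeriv u₂ g₂)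
    (hu₁ : LocallyIntegrable u₁ halfLine) (hg₁ : LocallyIntegrable g₁ halfLine)
    (hu₂ : LocallyIntegrable u₂ halfLine) (hg₂ : LocallyIntegrable g₂ halfLine) :
    IsWeakDeriv (fun t => u₁ t - u₂ t) (fun t => g₁ t - g₂ t) := by
  intro φ hφ hc hs
  have hφ' : Continuous (deriv φ) := hφ.continuous_deriv (by norm_cast)
  simp only [sub_mul]
  rw [integral_sub (integrable_mul_of_hasCompactSupport hu₁ hφ' hc.deriv)
      (integrable_mul_of_hasCompactSupport hu₂ hφ' hc.deriv),
    integral_sub (integrable_mul_of_hasCompactSupport hg₁ hφ.continuous hc)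
      (integrable_mul_of_hasCompactSupport hg₂ hφ.continuous hc),
    h₁ φ hφ hc hs, h₂ φ hφ hc hs]
  ring

theorem IsWeakDeriv.add_const_mul {u₁ g₁ u₂ g₂ : ℝ → ℝ} (h₁ : IsWeakDeriv u₁ g₁)
    (h₂ : IsWeakDeriv u₂ g₂)
    (hu₁ : LocallyIntegrable u₁ halfLine) (hg₁ : LocallyIntegrable g₁ halfLine)
    (hu₂ : LocallyIntegrable u₂ halfLine) (hg₂ : LocallyIntegrable g₂ halfLine) (c : ℝ) :
    IsWeakDeriv (fun t => u₁ t + c * u₂ t) (fun t => g₁ t + c * g₂ t) := by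
  intro φ hφ hc hs
  have hφ' : Continuous (deriv φ) := hφ.continuous_deriv (by norm_cast)
  simp only [add_mul, mul_assoc]
  rw [integral_add (integrable_mul_of_hasCompactSupport hu₁ hφ' hc.deriv)
      ((integrable_mul_of_hasCompactSupport hu₂ hφ' hc.deriv).const_mul c),
    integral_add (integrable_mul_of_hasCompactSupport hg₁ hφ.continuous hc)
      ((integrable_mul_of_hasCompactSupport hg₂ hφ.continuous hc).const_mul c),
    integral_const_mul, integral_const_mul, h₁ φ hφ hc hs, h₂ φ hφ hc hs]
  ring

/-! ### The du Bois-Reymond lemma. -/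

/-- There is a test function on the open half-line with integral one. -/
theorem exists_normalized_bump : ∃ ψ : ℝ → ℝ, ContDiff ℝ ∞ ψ ∧ HasCompactSupport ψ ∧
    tsupport ψ ⊆ Ioi 0 ∧ ∫ t, ψ t = 1 := by
  -- Centre `2` and outer radius `1` keep the support in `[1, 3]`.
  let c : ContDiffBump (2 : ℝ) := ⟨1 / 2, 1, by norm_num, by norm_num⟩
  refine ⟨c.normed volume, c.contDiff_normed, c.hasCompactSupport_normed, ?_,
    c.integral_normed⟩
  rw [c.tsupport_normed_eq]
  intro x hx
  rw [Metric.mem_closedBall, Real.dist_eq] at hx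
  have := (abs_le.1 hx).1
  change -1 ≤ x - 2 at this
  simp only [mem_Ioi]
  linarith

/-- A test function with vanishing integral is the derivative of a test function. -/
theorem exists_primitive_of_integral_eq_zero {θ : ℝ → ℝ} (hθ : ContDiff ℝ ∞ θ)
    (hc : HasCompactSupport θ) (hs : tsupport θ ⊆ Ioi 0) (h0 : ∫ t, θ t = 0) :
    ∃ Φ : ℝ → ℝ, ContDiff ℝ ∞ Φ ∧ HasCompactSupport Φ ∧ tsupport Φ ⊆ Ioi 0 ∧ deriv Φ = θ := by
  obtain ⟨a, T, ha, haT, hsub⟩ := exists_Icc_of_tsupport_subset hc hs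
  have hz : ∀ t, t ∉ Icc a T → θ t = 0 := fun t ht =>
    image_eq_zero_of_notMem_tsupport fun hh => ht (hsub hh)
  have hder : ∀ t, HasDerivAt (fun x => ∫ s in a..x, θ s) (θ t) t := fun t =>
    hθ.continuous.integral_hasStrictDerivAt a t |>.hasDerivAt
  have hderiv : deriv (fun x => ∫ s in a..x, θ s) = θ := funext fun t => (hder t).deriv
  have hsupp : Function.support (fun x => ∫ s in a..x, θ s) ⊆ Icc a T := by
    intro x hx
    by_contra hmem
    apply hx
    rcases lt_or_ge x a with hxa | hxa
    · change ∫ s in a..x, θ s = 0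
      rw [intervalIntegral.integral_symm, intervalIntegral.integral_of_le hxa.le,
        neg_eq_zero, integral_Ioc_eq_integral_Ioo]
      exact setIntegral_eq_zero_of_forall_eq_zero fun t ht => hz t fun h => by
        linarith [h.1, ht.2]
    · have hxT : T < x := by
        by_contra hcon
        exact hmem ⟨hxa, not_lt.1 hcon⟩
      change ∫ s in a..x, θ s = 0
      rw [← h0, intervalIntegral.integral_of_le hxa, integral_Ioc_eq_integral_Ioo,
        ← integral_Icc_eq_integral_Ioo]
      exact setIntegral_eq_integral_of_forall_compl_eq_zero fun t ht => hz t fun h =>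
        ht ⟨h.1, h.2.trans hxT.le⟩
  have hts : tsupport (fun x => ∫ s in a..x, θ s) ⊆ Icc a T :=
    closure_minimal hsupp isClosed_Icc
  refine ⟨fun x => ∫ s in a..x, θ s, ?_, ?_, ?_, hderiv⟩
  · rw [contDiff_infty_iff_deriv, hderiv]
    exact ⟨fun t => (hder t).differentiableAt, hθ⟩
  · exact HasCompactSupport.intro isCompact_Icc fun x hx => by
      by_contra hne
      exact hx (hsupp hne)
  · exact hts.trans fun x hx => lt_of_lt_of_le ha hx.1

/-- The du Bois-Reymond lemma on the half-line. -/
theorem ae_const_of_isWeakDeriv_zero {u : ℝ → ℝ} (hu : LocallyIntegrable u halfLine)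
    (h : IsWeakDeriv u (fun _ => 0)) : ∃ c : ℝ, ∀ᵐ t ∂halfLine, u t = c := by
  obtain ⟨ψ₀, hψ₀, hψ₀c, hψ₀s, hψ₀1⟩ := exists_normalized_bump
  refine ⟨∫ t, u t * ψ₀ t ∂halfLine, ?_⟩
  set c := ∫ t, u t * ψ₀ t ∂halfLine with hc_def
  have key : ∀ᵐ t ∂(volume : Measure ℝ), t ∈ Ioi (0 : ℝ) → u t - c = 0 := by
    refine isOpen_Ioi.ae_eq_zero_of_integral_contDiff_smul_eq_zero ?_ ?_
    · have h1 : LocallyIntegrable (fun t => u t - c) halfLine := by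
        refine hu.sub ?_
        exact locallyIntegrable_halfLine_of_continuousOn continuousOn_const
      exact locallyIntegrableOn_of_locallyIntegrable_restrict h1
    · intro ψ hψ hψc hψs
      have hint : ∀ ρ : ℝ → ℝ, tsupport ρ ⊆ Ioi 0 → ∫ t, ρ t = ∫ t, ρ t ∂halfLine := by
        intro ρ hρ
        refine (setIntegral_eq_integral_of_forall_compl_eq_zero fun t ht => ?_).symm
        exact image_eq_zero_of_notMem_tsupport fun hh => ht (hρ hh)
      -- Subtracting `m * ψ₀` gives a test function of integral zero, hence one of the form `deriv
      -- Φ`, against which `u` integrates to zero.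
      set m := ∫ t, ψ t with hm
      have iψ : Integrable ψ := hψ.continuous.integrable_of_hasCompactSupport hψc
      have iψ₀ : Integrable ψ₀ := hψ₀.continuous.integrable_of_hasCompactSupport hψ₀c
      have hts : tsupport (fun t => ψ t - m * ψ₀ t) ⊆ tsupport ψ ∪ tsupport ψ₀ := by
        refine closure_minimal (fun t ht => ?_)
          ((isClosed_tsupport ψ).union (isClosed_tsupport ψ₀))
        by_contra hcon
        simp only [mem_union, not_or] at hcon
        apply ht
        simp [image_eq_zero_of_notMem_tsupport hcon.1, image_eq_zero_of_notMem_tsupport hcon.2]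
      obtain ⟨Φ, hΦ, hΦc, hΦs, hΦd⟩ := exists_primitive_of_integral_eq_zero
        (θ := fun t => ψ t - m * ψ₀ t) (by fun_prop)
        ((hψc.isCompact.union hψ₀c.isCompact).of_isClosed_subset (isClosed_tsupport _) hts)
        (hts.trans (union_subset hψs hψ₀s))
        (by rw [integral_sub iψ (iψ₀.const_mul m), integral_const_mul, hψ₀1]; simp [hm])
      have h1 := h Φ hΦ hΦc hΦs
      rw [hΦd] at h1
      have i1 := integrable_mul_of_hasCompactSupport hu hψ.continuous hψc
      have i2 := integrable_mul_of_hasCompactSupport hu hψ₀.continuous hψ₀c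
      have h2 : ∫ t, u t * (ψ t - m * ψ₀ t) ∂halfLine
          = (∫ t, u t * ψ t ∂halfLine) - m * c := by
        rw [hc_def, ← integral_const_mul, ← integral_sub i1 (i2.const_mul m)]
        congr 1
        ext t
        ring
      rw [h2] at h1
      simp only [zero_mul, integral_zero, neg_zero] at h1
      rw [hint (fun t => ψ t • (u t - c))]
      · have h3 : ∫ t, ψ t • (u t - c) ∂halfLine
            = (∫ t, u t * ψ t ∂halfLine) - c * ∫ t, ψ t ∂halfLine := by
          rw [← integral_const_mul, ← integral_sub i1]
          · congr 1
            ext t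
            simp only [smul_eq_mul]
            ring
          · exact (iψ.mono_measure Measure.restrict_le_self).const_mul c
        rw [h3, ← hint ψ hψs]
        linarith
      · refine (closure_mono fun t ht => ?_).trans hψs
        intro hz
        apply ht
        simp [hz]
  unfold halfLine
  rw [ae_restrict_iff' measurableSet_Ioi]
  filter_upwards [key] with t ht hmem
  linarith [ht hmem]

/-! ### Primitives and continuous representatives. -/

theorem absolutelyContinuousOnInterval_primitive {g : ℝ → ℝ} (hg : LocallyIntegrable g halfLine)
    {T : ℝ} (hT : 0 ≤ T) : AbsolutelyContinuousOnInterval (fun t => ∫ s in (0 : ℝ)..t, g s) 0 T :=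
  (intervalIntegrable_of_locallyIntegrable hg hT).absolutelyContinuousOnInterval_intervalIntegral
    left_mem_uIcc

theorem continuousOn_Ici_of_absolutelyContinuous {h : ℝ → ℝ}
    (hac : ∀ T, 0 ≤ T → AbsolutelyContinuousOnInterval h 0 T) : ContinuousOn h (Ici 0) := by
  intro t ht
  have ht' : (0 : ℝ) ≤ t := ht
  have h1 := (hac (t + 1) (by linarith)).continuousOn t (by
    rw [uIcc_of_le (by linarith)]
    exact ⟨ht, by linarith⟩)
  refine h1.mono_of_mem_nhdsWithin ?_
  rw [uIcc_of_le (by linarith), ← Ici_inter_Iic]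
  exact inter_mem_nhdsWithin _ (Iic_mem_nhds (by linarith))

/-- Lebesgue differentiation on each `[0, n]`, glued by countability. -/
theorem ae_deriv_primitive {g : ℝ → ℝ} (hg : LocallyIntegrable g halfLine) :
    ∀ᵐ t ∂halfLine, HasDerivAt (fun t => ∫ s in (0 : ℝ)..t, g s) (g t) t := by
  unfold halfLine
  rw [ae_restrict_iff' measurableSet_Ioi]
  have h : ∀ n : ℕ, ∀ᵐ x, x ∈ uIcc (0 : ℝ) n → ∀ c ∈ uIcc (0 : ℝ) n,
      HasDerivAt (fun x => ∫ t in c..x, g t) (g x) x := fun n =>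
    (intervalIntegrable_of_locallyIntegrable hg n.cast_nonneg).ae_hasDerivAt_integral
  rw [← ae_all_iff] at h
  filter_upwards [h] with t ht hmem
  obtain ⟨n, hn⟩ := exists_nat_ge t
  have hpos : 0 < t := hmem
  exact ht n (by rw [uIcc_of_le (by linarith)]; exact ⟨hpos.le, hn⟩) 0 left_mem_uIcc

/-- A function with a locally integrable weak derivative is a.e. a primitive of it. -/
theorem IsWeakDeriv.ae_eq_primitive {u g : ℝ → ℝ} (h : IsWeakDeriv u g)
    (hu : LocallyIntegrable u halfLine) (hg : LocallyIntegrable g halfLine) :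
    ∃ c : ℝ, ∀ᵐ t ∂halfLine, u t = c + ∫ s in (0 : ℝ)..t, g s := by
  have hac := fun T hT => absolutelyContinuousOnInterval_primitive hg (T := T) hT
  have hw : IsWeakDeriv (fun t => ∫ s in (0 : ℝ)..t, g s) g :=
    isWeakDeriv_of_absolutelyContinuous hac
      ((ae_deriv_primitive hg).mono fun t ht => ht.deriv)
  have hl : LocallyIntegrable (fun t => ∫ s in (0 : ℝ)..t, g s) halfLine :=
    locallyIntegrable_halfLine_of_continuousOn (continuousOn_Ici_of_absolutelyContinuous hac)
  have h0 := h.sub hw hu hg hl hg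
  simp only [sub_self] at h0
  obtain ⟨c, hc⟩ := ae_const_of_isWeakDeriv_zero (hu.sub hl) h0
  refine ⟨c, hc.mono fun t ht => ?_⟩
  rw [Pi.sub_apply] at ht
  linarith

theorem eqOn_Ici_of_ae_eq {u v : ℝ → ℝ} (hu : ContinuousOn u (Ici 0))
    (hv : ContinuousOn v (Ici 0)) (h : ∀ᵐ t ∂halfLine, u t = v t) : EqOn u v (Ici 0) := by
  have h1 : u =ᵐ[volume.restrict (Ici 0)] v := by
    rw [← restrict_Ioi_eq_restrict_Ici]
    exact h
  exact Measure.eqOn_of_ae_eq h1 hu hv (by rw [interior_Ici, closure_Ioi])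

/-- A continuous function is the primitive of its weak derivative. -/
theorem IsWeakDeriv.eq_primitive {u g : ℝ → ℝ} (h : IsWeakDeriv u g)
    (hu : ContinuousOn u (Ici 0)) (hg : LocallyIntegrable g halfLine) {t : ℝ} (ht : 0 ≤ t) :
    u t = u 0 + ∫ s in (0 : ℝ)..t, g s := by
  obtain ⟨c, hc⟩ := h.ae_eq_primitive (locallyIntegrable_halfLine_of_continuousOn hu) hg
  have he := eqOn_Ici_of_ae_eq hu (continuousOn_const.add
    (continuousOn_Ici_of_absolutelyContinuous
      fun T hT => absolutelyContinuousOnInterval_primitive hg hT)) hc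
  have h0 := he (mem_Ici.2 le_rfl)
  have h1 := he (mem_Ici.2 ht)
  simp at h0 h1
  rw [h0, h1]

/-! ### Boundedness of `H¹` functions and integrability of the energy density. -/

theorem integrableOn_Ioc_of_integrable_halfLine {F : ℝ → ℝ} (hF : Integrable F halfLine) {s t : ℝ}
    (hs : 0 ≤ s) : IntegrableOn F (Ioc s t) :=
  IntegrableOn.mono_set (show IntegrableOn F (Ioi 0) volume from hF)
    fun _ hx => lt_of_le_of_lt hs hx.1

theorem intervalIntegral_le_integral_halfLine {F : ℝ → ℝ} (hF : Integrable F halfLine)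
    (h0 : ∀ t, 0 ≤ F t) {s t : ℝ} (hs : 0 ≤ s) (hst : s ≤ t) :
    ∫ x in s..t, F x ≤ ∫ x, F x ∂halfLine := by
  rw [intervalIntegral.integral_of_le hst]
  exact setIntegral_mono_set hF (Eventually.of_forall h0)
    (Eventually.of_forall fun _ hx => lt_of_le_of_lt hs hx.1)

/-- Continuous representatives of `H¹(ℝ⁺)` functions are bounded. -/
theorem MemH1.exists_bound {f g : ℝ → ℝ} (h : MemH1 f g) (hf : ContinuousOn f (Ici 0)) :
    ∃ M : ℝ, ∀ t, 0 ≤ t → f t ^ 2 ≤ M := by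
  have hg := memLp_two_locallyIntegrable h.memLp_deriv
  have hg2 : Integrable (fun t => g t ^ 2) halfLine := h.memLp_deriv.integrable_sq
  have hf2 : Integrable (fun t => f t ^ 2) halfLine := h.memLp.integrable_sq
  -- Since `|g| ≤ (1 + g²) / 2`, this bounds the oscillation of `f` on any interval of length at
  -- most one; averaging the bound on `f t ^ 2` over `s ∈ [t, t + 1]` then concludes.
  set C := (1 + ∫ t, g t ^ 2 ∂halfLine) / 2 with hC
  refine ⟨2 * (∫ t, f t ^ 2 ∂halfLine) + 2 * C ^ 2, fun t ht => ?_⟩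
  have ht1 : t ≤ t + 1 := by linarith
  have hdiff : ∀ s ∈ Icc t (t + 1), f t ^ 2 ≤ 2 * f s ^ 2 + 2 * C ^ 2 := by
    intro s hs
    have hs0 : 0 ≤ s := ht.trans hs.1
    have e1 := h.isWeakDeriv.eq_primitive hf hg ht
    have e2 := h.isWeakDeriv.eq_primitive hf hg hs0
    have hts : IntervalIntegrable g volume t s :=
      (intervalIntegrable_of_locallyIntegrable hg ht).symm.trans
        (intervalIntegrable_of_locallyIntegrable hg hs0)
    have e3 : f s - f t = ∫ x in t..s, g x := by
      rw [e1, e2, add_sub_add_left_eq_sub, intervalIntegral.integral_interval_sub_left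
        (intervalIntegrable_of_locallyIntegrable hg hs0)
        (intervalIntegrable_of_locallyIntegrable hg ht)]
    have i2 : IntervalIntegrable (fun x => g x ^ 2) volume t s := by
      rw [intervalIntegrable_iff_integrableOn_Ioc_of_le hs.1]
      exact integrableOn_Ioc_of_integrable_halfLine hg2 ht
    have e4 : |f s - f t| ≤ C := by
      rw [e3]
      calc |∫ x in t..s, g x| ≤ ∫ x in t..s, |g x| :=
            intervalIntegral.abs_integral_le_integral_abs hs.1
        _ ≤ ∫ x in t..s, (1 + g x ^ 2) / 2 := by
            refine intervalIntegral.integral_mono_on hs.1 hts.abs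
              ((intervalIntegrable_const.add i2).div_const 2) fun x _ => ?_
            nlinarith [sq_nonneg (|g x| - 1), sq_abs (g x)]
        _ = ((s - t) + ∫ x in t..s, g x ^ 2) / 2 := by
            rw [intervalIntegral.integral_div,
              intervalIntegral.integral_add intervalIntegrable_const i2]
            simp
        _ ≤ C := by
            have := intervalIntegral_le_integral_halfLine hg2 (fun x => sq_nonneg _) ht hs.1
            rw [hC]
            linarith [hs.2]
    have e5 : (f s - f t) ^ 2 ≤ C ^ 2 := sq_le_sq' (abs_le.1 e4).1 (abs_le.1 e4).2
    nlinarith [sq_nonneg (2 * f s - f t)]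
  have i1 : IntervalIntegrable (fun x => f x ^ 2) volume t (t + 1) := by
    rw [intervalIntegrable_iff_integrableOn_Ioc_of_le ht1]
    exact integrableOn_Ioc_of_integrable_halfLine hf2 ht
  have key := intervalIntegral.integral_mono_on ht1
    (intervalIntegrable_const (c := f t ^ 2) (μ := volume))
    ((i1.const_mul 2).add (intervalIntegrable_const (c := 2 * C ^ 2))) hdiff
  rw [intervalIntegral.integral_add (i1.const_mul 2) intervalIntegrable_const,
    intervalIntegral.integral_const_mul] at key
  simp at key
  linarith [intervalIntegral_le_integral_halfLine hf2 (fun x => sq_nonneg _) ht ht1]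

theorem ae_halfLine_pos : ∀ᵐ t ∂halfLine, 0 < t := by
  unfold halfLine
  exact ae_restrict_mem measurableSet_Ioi

theorem MemH1.integrable_pow_four {f g : ℝ → ℝ} (h : MemH1 f g) (hf : ContinuousOn f (Ici 0)) :
    Integrable (fun t => f t ^ 4) halfLine := by
  obtain ⟨M, hM⟩ := h.exists_bound hf
  have hf2 : Integrable (fun t => f t ^ 2) halfLine := h.memLp.integrable_sq
  refine (hf2.const_mul M).mono (h.memLp.aestronglyMeasurable.pow 4) ?_
  filter_upwards [ae_halfLine_pos] with t ht
  rw [Real.norm_of_nonneg (by positivity)]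
  refine le_trans ?_ (le_abs_self _)
  nlinarith [hM t ht.le, sq_nonneg (f t)]

theorem FiniteEnergy.memLp_shift {f g : ℝ → ℝ} (h : FiniteEnergy f g) (α : ℝ) :
    MemLp (fun t => (t + α) * f t) 2 halfLine := by
  have := h.memLp_mul.add (h.memLp.const_mul α)
  refine this.congr_norm ?_ ?_
  · have := this.aestronglyMeasurable
    refine this.congr (Eventually.of_forall fun t => ?_)
    simp [add_mul]
  · exact Eventually.of_forall fun t => by simp [add_mul]

theorem FiniteEnergy.integrable_shift_sq {f g : ℝ → ℝ} (h : FiniteEnergy f g) (α : ℝ) :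
    Integrable (fun t => (t + α) ^ 2 * f t ^ 2) halfLine := by
  have := (h.memLp_shift α).integrable_sq
  simpa only [mul_pow] using this

theorem FiniteEnergy.integrable_energyDensity {f g : ℝ → ℝ} (h : FiniteEnergy f g)
    (hf : ContinuousOn f (Ici 0)) (b α : ℝ) :
    Integrable (fun t => g t ^ 2 + (t + α) ^ 2 * f t ^ 2
      - 1 / (2 * b) * (2 * f t ^ 2 - f t ^ 4)) halfLine :=
  (h.memLp_deriv.integrable_sq.add (h.integrable_shift_sq α)).sub
    (((h.memLp.integrable_sq.const_mul 2).sub (h.toMemH1.integrable_pow_four hf)).const_mul _)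

/-! ### Passage to a nonnegative minimizer. -/

/-- Absolute continuity passes to functions with smaller increments. -/
theorem absolutelyContinuousOnInterval_of_dist_le {f h : ℝ → ℝ} {a b : ℝ}
    (hf : AbsolutelyContinuousOnInterval f a b)
    (hd : ∀ x ∈ uIcc a b, ∀ y ∈ uIcc a b, dist (h x) (h y) ≤ dist (f x) (f y)) :
    AbsolutelyContinuousOnInterval h a b := by
  rw [absolutelyContinuousOnInterval_iff] at hf ⊢
  intro ε hε
  obtain ⟨δ, hδ, H⟩ := hf ε hε
  refine ⟨δ, hδ, fun E hE hlt => lt_of_le_of_lt ?_ (H E hE hlt)⟩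
  exact Finset.sum_le_sum fun i hi => hd _ (hE.1 i hi).1 _ (hE.1 i hi).2

theorem abs_deriv_le_of_dist_le {f h : ℝ → ℝ} {f' t : ℝ} (hf : HasDerivAt f f' t)
    (hd : ∀ᶠ s in 𝓝 t, dist (h s) (h t) ≤ dist (f s) (f t)) : |deriv h t| ≤ |f'| := by
  by_cases hh : DifferentiableAt ℝ h t
  · have h1 := hh.hasDerivAt.tendsto_slope.abs
    have h2 := hf.tendsto_slope.abs
    refine le_of_tendsto_of_tendsto h1 h2 ?_
    filter_upwards [nhdsWithin_le_nhds hd] with s hs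
    rw [Real.dist_eq, Real.dist_eq] at hs
    simp only [slope_def_field, abs_div]
    gcongr
  -- Where `h` is not differentiable, `deriv` takes the default value `0`.
  · rw [deriv_zero_of_not_differentiableAt hh, abs_zero]
    exact abs_nonneg _

/-- The absolute value of a minimizer, extended constantly to the left, is a minimizer. -/
theorem IsMinimizingPair.exists_nonneg {b α₀ : ℝ} {f₀ : ℝ → ℝ} (hmin : IsMinimizingPair b f₀ α₀) :
    ∃ h g : ℝ → ℝ, Continuous h ∧ (∀ t, 0 ≤ h t) ∧ (∀ t, 0 ≤ t → h t = |f₀ t|) ∧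
      FiniteEnergy h g ∧
      ∀ (α : ℝ) (f k : ℝ → ℝ), FiniteEnergy f k → energy b α₀ h g ≤ energy b α f k := by
  obtain ⟨hc, g₀, hfin, hle⟩ := hmin
  -- The `max` makes `h` continuous on all of `ℝ`, whereas `f₀` is controlled only on `[0, ∞)`.
  set h : ℝ → ℝ := fun t => |f₀ (max t 0)| with hh
  have hcont : Continuous h :=
    (hc.comp_continuous (by fun_prop) fun t => le_max_right t 0).abs
  have heq : ∀ t, 0 ≤ t → h t = |f₀ t| := fun t ht => by simp [hh, max_eq_left ht]
  have hg₀ := memLp_two_locallyIntegrable hfin.memLp_deriv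
  set p : ℝ → ℝ := fun t => ∫ s in (0 : ℝ)..t, g₀ s with hp
  -- By the reverse triangle inequality; this yields both the absolute continuity of `h` and `|h'| ≤
  -- |g₀|` a.e., so the energy does not increase.
  have hdist : ∀ x, 0 ≤ x → ∀ y, 0 ≤ y → dist (h x) (h y) ≤ dist (p x) (p y) := by
    intro x hx y hy
    rw [heq x hx, heq y hy, Real.dist_eq, Real.dist_eq,
      hfin.isWeakDeriv.eq_primitive hc hg₀ hx, hfin.isWeakDeriv.eq_primitive hc hg₀ hy]
    refine (abs_abs_sub_abs_le_abs_sub _ _).trans (le_of_eq ?_)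
    simp [hp]
  have hac : ∀ T, 0 ≤ T → AbsolutelyContinuousOnInterval h 0 T := fun T hT =>
    absolutelyContinuousOnInterval_of_dist_le
      (absolutelyContinuousOnInterval_primitive hg₀ hT) fun x hx y hy => by
        rw [uIcc_of_le hT] at hx hy
        exact hdist x hx.1 y hy.1
  have hder : ∀ᵐ t ∂halfLine, |deriv h t| ≤ |g₀ t| := by
    filter_upwards [ae_deriv_primitive hg₀, ae_halfLine_pos] with t ht hpos
    refine abs_deriv_le_of_dist_le ht ?_
    filter_upwards [Ioi_mem_nhds hpos] with s hs
    exact hdist s (le_of_lt hs) t hpos.le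
  have habs : ∀ᵐ t ∂halfLine, h t = |f₀ t| := ae_halfLine_pos.mono fun t ht => heq t ht.le
  have hfinh : FiniteEnergy h (deriv h) :=
    { memLp := hfin.memLp.congr_norm hcont.aestronglyMeasurable
        (habs.mono fun t ht => by rw [ht]; simp)
      memLp_deriv := hfin.memLp_deriv.mono (measurable_deriv h).aestronglyMeasurable hder
      isWeakDeriv := isWeakDeriv_of_absolutelyContinuous hac (Eventually.of_forall fun _ => rfl)
      memLp_mul := hfin.memLp_mul.congr_norm (by fun_prop)
        (habs.mono fun t ht => by rw [ht]; simp) }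
  refine ⟨h, deriv h, hcont, fun t => abs_nonneg _, heq, hfinh, fun α f k hfk => ?_⟩
  refine le_trans ?_ (hle α f k hfk)
  refine integral_mono_ae (hfinh.integrable_energyDensity hcont.continuousOn b α₀)
    (hfin.integrable_energyDensity hc b α₀) ?_
  filter_upwards [hder, habs] with t h1 h2
  have h3 : deriv h t ^ 2 ≤ g₀ t ^ 2 := sq_le_sq.2 h1
  have h4 : h t ^ 4 = f₀ t ^ 4 := by rw [h2, pow_abs]; exact abs_of_nonneg (by positivity)
  have h5 : h t ^ 2 = f₀ t ^ 2 := by rw [h2, sq_abs]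
  simp only [h4, h5]
  linarith

/-! ### First variations in the function and in the shift. -/

/-- The polynomial has a minimum at `0`, where its derivative is `a`. The energy is exactly quartic
in `ε` along `f + ε φ` and quadratic in the shift, so no differentiation under the integral is
needed. -/
theorem eq_zero_of_quartic_nonneg {a b c d : ℝ}
    (h : ∀ x : ℝ, 0 ≤ x * a + x ^ 2 * b + x ^ 3 * c + x ^ 4 * d) : a = 0 := by
  have hd : HasDerivAt (fun x : ℝ => x * a + x ^ 2 * b + x ^ 3 * c + x ^ 4 * d) a 0 := by
    have := ((((hasDerivAt_id (0 : ℝ)).mul_const a).add ((hasDerivAt_pow 2 (0 : ℝ)).mul_const b)).add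
      ((hasDerivAt_pow 3 (0 : ℝ)).mul_const c)).add ((hasDerivAt_pow 4 (0 : ℝ)).mul_const d)
    refine this.congr_deriv ?_
    simp
  have hm : IsLocalMin (fun x : ℝ => x * a + x ^ 2 * b + x ^ 3 * c + x ^ 4 * d) 0 :=
    Eventually.of_forall fun x => by simpa using h x
  exact hm.hasDerivAt_eq_zero hd

theorem FiniteEnergy.add_const_mul {f g φ : ℝ → ℝ} (h : FiniteEnergy f g) (hφ : ContDiff ℝ ∞ φ)
    (hc : HasCompactSupport φ) (ε : ℝ) :
    FiniteEnergy (fun t => f t + ε * φ t) (fun t => g t + ε * deriv φ t) := by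
  have hφ' : Continuous (deriv φ) := hφ.continuous_deriv (by norm_cast)
  have m1 : MemLp φ 2 halfLine :=
    (hφ.continuous.memLp_of_hasCompactSupport hc (μ := volume)).mono_measure
      Measure.restrict_le_self
  have m2 : MemLp (deriv φ) 2 halfLine :=
    (hφ'.memLp_of_hasCompactSupport hc.deriv (μ := volume)).mono_measure
      Measure.restrict_le_self
  have m3 : MemLp (fun t => t * φ t) 2 halfLine :=
    ((continuous_id.mul hφ.continuous).memLp_of_hasCompactSupport (hc.mul_left (f := id))
      (μ := volume)).mono_measure Measure.restrict_le_self
  have hw : IsWeakDeriv φ (deriv φ) :=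
    isWeakDeriv_of_absolutelyContinuous
      (fun T _ => (hφ.of_le (by norm_cast)).contDiffOn.absolutelyContinuousOnInterval)
      (Eventually.of_forall fun _ => rfl)
  refine ⟨⟨h.memLp.add (m1.const_mul ε), h.memLp_deriv.add (m2.const_mul ε),
    h.isWeakDeriv.add_const_mul hw (memLp_two_locallyIntegrable h.memLp)
      (memLp_two_locallyIntegrable h.memLp_deriv) (memLp_two_locallyIntegrable m1)
      (memLp_two_locallyIntegrable m2) ε⟩, ?_⟩
  have := h.memLp_mul.add (m3.const_mul ε)
  convert this using 1
  ext t
  simp only [Pi.add_apply]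
  ring

/-- The Euler-Lagrange equation in weak form. -/
theorem isWeakDeriv_deriv_of_minimal {b α : ℝ} {f g : ℝ → ℝ} (hf : Continuous f)
    (h : FiniteEnergy f g)
    (hmin : ∀ u v : ℝ → ℝ, FiniteEnergy u v → energy b α f g ≤ energy b α u v) :
    IsWeakDeriv g (fun t => (t + α) ^ 2 * f t - 1 / b * (f t - f t ^ 3)) := by
  intro φ hφ hc hs
  have hφ' : Continuous (deriv φ) := hφ.continuous_deriv (by norm_cast)
  have hcont : ∀ u : ℝ → ℝ, Continuous u → ∀ ρ : ℝ → ℝ, Continuous ρ → HasCompactSupport ρ →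
      Integrable (fun t => u t * ρ t) halfLine := fun u hu ρ hρ hρc =>
    integrable_mul_of_hasCompactSupport
      (locallyIntegrable_halfLine_of_continuousOn hu.continuousOn) hρ hρc
  have i0 := h.integrable_energyDensity hf.continuousOn b α
  have iA : Integrable (fun t => g t * deriv φ t) halfLine :=
    integrable_mul_of_hasCompactSupport (memLp_two_locallyIntegrable h.memLp_deriv) hφ' hc.deriv
  have iB : Integrable (fun t => ((t + α) ^ 2 * f t - 1 / b * (f t - f t ^ 3)) * φ t) halfLine :=
    hcont _ (by fun_prop) φ hφ.continuous hc
  -- `P1`, ..., `P4` are the coefficients of `ε`, ..., `ε ^ 4` in the density at `f + ε φ`. Each is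
  -- a sum of products with a compactly supported last factor, hence integrable.
  set P1 : ℝ → ℝ := fun t => 2 * (g t * deriv φ t
    + ((t + α) ^ 2 * f t - 1 / b * (f t - f t ^ 3)) * φ t) with hP1
  set P2 : ℝ → ℝ := fun t => deriv φ t * deriv φ t
    + ((t + α) ^ 2 * φ t - 1 / b * (φ t - 3 * f t ^ 2 * φ t)) * φ t with hP2
  set P3 : ℝ → ℝ := fun t => (2 / b * f t * φ t ^ 2) * φ t with hP3
  set P4 : ℝ → ℝ := fun t => (1 / (2 * b) * φ t ^ 3) * φ t with hP4
  have i1 : Integrable P1 halfLine := (iA.add iB).const_mul 2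
  have cφ := hφ.continuous
  have i2 : Integrable P2 halfLine :=
    (hcont _ hφ' _ hφ' hc.deriv).add (hcont _ (by fun_prop) φ cφ hc)
  have i3 : Integrable P3 halfLine := hcont _ (by fun_prop) φ cφ hc
  have i4 : Integrable P4 halfLine := hcont _ (by fun_prop) φ cφ hc
  have expand : ∀ ε : ℝ, energy b α (fun t => f t + ε * φ t) (fun t => g t + ε * deriv φ t)
      = energy b α f g + (ε * (∫ t, P1 t ∂halfLine) + ε ^ 2 * (∫ t, P2 t ∂halfLine)
        + ε ^ 3 * (∫ t, P3 t ∂halfLine) + ε ^ 4 * (∫ t, P4 t ∂halfLine)) := by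
    intro ε
    have j2 : Integrable (fun t => ε * P1 t + ε ^ 2 * P2 t) halfLine :=
      (i1.const_mul _).add (i2.const_mul _)
    have j3 : Integrable (fun t => ε * P1 t + ε ^ 2 * P2 t + ε ^ 3 * P3 t) halfLine :=
      j2.add (i3.const_mul _)
    have j4 : Integrable (fun t => ε * P1 t + ε ^ 2 * P2 t + ε ^ 3 * P3 t + ε ^ 4 * P4 t)
        halfLine := j3.add (i4.const_mul _)
    unfold energy
    rw [← integral_const_mul, ← integral_const_mul, ← integral_const_mul, ← integral_const_mul,
      ← integral_add (i1.const_mul _) (i2.const_mul _), ← integral_add j2 (i3.const_mul _),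
      ← integral_add j3 (i4.const_mul _), ← integral_add i0 j4]
    congr 1
    ext t
    simp only [hP1, hP2, hP3, hP4]
    ring
  have hzero : ∫ t, P1 t ∂halfLine = 0 := by
    refine eq_zero_of_quartic_nonneg (b := ∫ t, P2 t ∂halfLine) (c := ∫ t, P3 t ∂halfLine)
      (d := ∫ t, P4 t ∂halfLine) fun ε => ?_
    have := hmin _ _ (h.add_const_mul hφ hc ε)
    rw [expand] at this
    linarith
  rw [hP1, integral_const_mul, integral_add iA iB] at hzero
  linarith

/-- Optimality of the shift. -/
theorem integral_shift_mul_sq_eq_zero {b α : ℝ} {f g : ℝ → ℝ} (hf : Continuous f)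
    (h : FiniteEnergy f g) (hmin : ∀ β : ℝ, energy b α f g ≤ energy b β f g) :
    Integrable (fun t => (t + α) * f t ^ 2) halfLine ∧
      ∫ t, (t + α) * f t ^ 2 ∂halfLine = 0 := by
  have i1 : Integrable (fun t => (t + α) * f t ^ 2) halfLine := by
    have := (h.memLp_shift α).integrable_mul h.memLp
    refine this.congr (Eventually.of_forall fun t => ?_)
    simp only [Pi.mul_apply]
    ring
  have i2 : Integrable (fun t => f t ^ 2) halfLine := h.memLp.integrable_sq
  have i0 := h.integrable_energyDensity hf.continuousOn b α
  refine ⟨i1, ?_⟩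
  have expand : ∀ x : ℝ, energy b (α + x) f g = energy b α f g
      + (x * (2 * ∫ t, (t + α) * f t ^ 2 ∂halfLine) + x ^ 2 * ∫ t, f t ^ 2 ∂halfLine) := by
    intro x
    have j : Integrable (fun t => x * (2 * ((t + α) * f t ^ 2)) + x ^ 2 * f t ^ 2) halfLine :=
      ((i1.const_mul _).const_mul _).add (i2.const_mul _)
    unfold energy
    rw [← integral_const_mul, ← integral_const_mul, ← integral_const_mul,
      ← integral_add ((i1.const_mul _).const_mul _) (i2.const_mul _), ← integral_add i0 j]
    congr 1
    ext t
    ring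
  have := eq_zero_of_quartic_nonneg (a := 2 * ∫ t, (t + α) * f t ^ 2 ∂halfLine)
    (b := ∫ t, f t ^ 2 ∂halfLine) (c := 0) (d := 0) fun x => by
      have := hmin (α + x)
      rw [expand] at this
      linarith
  linarith

/-- A minimizer is a classical solution of the Euler-Lagrange equation on `(0, ∞)`. -/
theorem exists_hasDerivAt_of_minimal {b α : ℝ} {f g : ℝ → ℝ} (hf : Continuous f)
    (h : FiniteEnergy f g)
    (hmin : ∀ u v : ℝ → ℝ, FiniteEnergy u v → energy b α f g ≤ energy b α u v) :
    ∃ G : ℝ → ℝ, (∀ᵐ t ∂halfLine, g t = G t) ∧ (∀ t, 0 < t → HasDerivAt f (G t) t) ∧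
      ∀ t, 0 < t → HasDerivAt G ((t + α) ^ 2 * f t - 1 / b * (f t - f t ^ 3)) t := by
  have hg := memLp_two_locallyIntegrable h.memLp_deriv
  have hw : Continuous fun t => (t + α) ^ 2 * f t - 1 / b * (f t - f t ^ 3) := by fun_prop
  obtain ⟨c, hc⟩ := (isWeakDeriv_deriv_of_minimal hf h hmin).ae_eq_primitive hg
    (locallyIntegrable_halfLine_of_continuousOn hw.continuousOn)
  -- The weak derivative of `g` is continuous, so `g` has this `C¹` representative, and `f`, a
  -- primitive of it, is `C²` on `(0, ∞)`.
  set G : ℝ → ℝ := fun t => c + ∫ s in (0 : ℝ)..t,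
    ((s + α) ^ 2 * f s - 1 / b * (f s - f s ^ 3)) with hG
  have hGd : ∀ t, HasDerivAt G ((t + α) ^ 2 * f t - 1 / b * (f t - f t ^ 3)) t := fun t =>
    (hw.integral_hasStrictDerivAt 0 t).hasDerivAt.const_add c
  have hGc : Continuous G := continuous_iff_continuousAt.2 fun t => (hGd t).continuousAt
  refine ⟨G, hc, fun t ht => ?_, fun t _ => hGd t⟩
  have hprim : ∀ s, 0 < s → f s = f 0 + ∫ x in (0 : ℝ)..s, G x := by
    intro s hs
    rw [h.isWeakDeriv.eq_primitive hf.continuousOn hg hs.le, intervalIntegral.integral_of_le hs.le,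
      intervalIntegral.integral_of_le hs.le]
    congr 1
    apply integral_congr_ae
    exact (MeasureTheory.ae_mono (Measure.restrict_mono (fun x hx => hx.1) le_rfl) :
      ae (volume.restrict (Ioc 0 s)) ≤ ae (volume.restrict (Ioi 0))) hc
  refine ((hGc.integral_hasStrictDerivAt 0 t).hasDerivAt.const_add (f 0)).congr_of_eventuallyEq ?_
  filter_upwards [Ioi_mem_nhds ht] with s hs
  exact hprim s hs

/-! ### The first integral and the minimum argument. -/

/-- The first integral of the Euler-Lagrange equation: the potential function
`2 ∫₀ᵗ (η + α) f²` has no nonlocal term. -/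
theorem two_mul_integral_shift_mul_sq_eq {b α : ℝ} {f G : ℝ → ℝ} (hf : Continuous f)
    (h : FiniteEnergy f G)
    (hfG : ∀ t, 0 < t → HasDerivAt f (G t) t)
    (hG : ∀ t, 0 < t → HasDerivAt G ((t + α) ^ 2 * f t - 1 / b * (f t - f t ^ 3)) t)
    (hi : Integrable (fun t => (t + α) * f t ^ 2) halfLine)
    (h0 : ∫ t, (t + α) * f t ^ 2 ∂halfLine = 0) {t : ℝ} (ht : 0 < t) :
    2 * ∫ η in (0 : ℝ)..t, (η + α) * f η ^ 2
      = (t + α) ^ 2 * f t ^ 2 - 1 / (2 * b) * (2 * f t ^ 2 - f t ^ 4) - G t ^ 2 := by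
  set F : ℝ → ℝ := fun t => 2 * ∫ η in (0 : ℝ)..t, (η + α) * f η ^ 2 with hF
  set R : ℝ → ℝ := fun t =>
    (t + α) ^ 2 * f t ^ 2 - 1 / (2 * b) * (2 * f t ^ 2 - f t ^ 4) - G t ^ 2 with hR
  have hFd : ∀ t, HasDerivAt F (2 * ((t + α) * f t ^ 2)) t := fun t =>
    ((show Continuous fun η => (η + α) * f η ^ 2 by fun_prop).integral_hasStrictDerivAt
      0 t).hasDerivAt.const_mul 2
  have hRd : ∀ t, 0 < t → HasDerivAt R (2 * ((t + α) * f t ^ 2)) t := by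
    intro t ht
    have h1 := (((hasDerivAt_id t).add_const α).pow 2).mul ((hfG t ht).pow 2)
    have h2 := ((((hfG t ht).pow 2).const_mul 2).sub ((hfG t ht).pow 4)).const_mul (1 / (2 * b))
    have h3 := (h1.sub h2).sub ((hG t ht).pow 2)
    refine h3.congr_deriv ?_
    simp only [id, Pi.pow_apply]
    norm_num
    ring
  have hdiff : ∀ t, 0 < t → HasDerivAt (fun s => R s - F s) 0 t := fun t ht =>
    ((hRd t ht).sub (hFd t)).congr_deriv (sub_self _)
  have hconst : ∀ s, 0 < s → R s = (R t - F t) + F s := by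
    intro s hs
    have := isOpen_Ioi.is_const_of_deriv_eq_zero (convex_Ioi (0 : ℝ)).isPreconnected
      (fun x hx => (hdiff x hx).differentiableAt.differentiableWithinAt)
      (fun x hx => (hdiff x hx).deriv) hs ht
    linarith
  have hlim : Tendsto F atTop (𝓝 0) := by
    have := (intervalIntegral_tendsto_integral_Ioi 0 hi tendsto_id).const_mul 2
    unfold halfLine at h0
    rw [h0, mul_zero] at this
    exact this
  have hRlim : Tendsto R atTop (𝓝 (R t - F t)) := by
    have := hlim.const_add (R t - F t)
    rw [add_zero] at this
    refine this.congr' ?_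
    filter_upwards [Ioi_mem_atTop 0] with s hs
    exact (hconst s hs).symm
  have hRint : Integrable R halfLine :=
    ((h.integrable_shift_sq α).sub (((h.memLp.integrable_sq.const_mul 2).sub
      (h.toMemH1.integrable_pow_four hf.continuousOn)).const_mul _)).sub
      h.memLp_deriv.integrable_sq
  have hz : R t - F t = 0 := by
    -- An integrable function with a limit at infinity has limit `0`, as neighbourhoods of infinity
    -- have infinite measure.
    refine IntegrableAtFilter.eq_zero_of_tendsto (μ := volume) (l := atTop)
      ⟨Ioi 0, Ioi_mem_atTop 0, hRint⟩ (fun s hs => ?_) hRlim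
    obtain ⟨x, hx⟩ := mem_atTop_sets.1 hs
    rw [← top_le_iff, ← Real.volume_Ici (a := x)]
    exact measure_mono hx
  change F t = R t
  linarith

theorem FiniteEnergy.congr_deriv {f g G : ℝ → ℝ} (h : FiniteEnergy f g)
    (hG : ∀ᵐ t ∂halfLine, g t = G t) : FiniteEnergy f G := by
  refine ⟨⟨h.memLp, h.memLp_deriv.ae_eq hG, fun φ hφ hc hs => ?_⟩, h.memLp_mul⟩
  rw [h.isWeakDeriv φ hφ hc hs]
  congr 1
  exact integral_congr_ae (hG.mono fun t ht => by simp only [ht])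

/-- Positivity of the cost function of a nonnegative minimizer. -/
theorem costK0_nonneg_of_nonneg {b α : ℝ} {f g : ℝ → ℝ} (hb : 1 ≤ b) (hf : Continuous f)
    (hpos : ∀ t, 0 ≤ f t) (h : FiniteEnergy f g)
    (hmin : ∀ (β : ℝ) (u v : ℝ → ℝ), FiniteEnergy u v → energy b α f g ≤ energy b β u v)
    {t : ℝ} (ht : 0 ≤ t) : 0 ≤ costK0 f α t := by
  obtain ⟨G, hgG, hfG, hG⟩ := exists_hasDerivAt_of_minimal hf h (hmin α)
  obtain ⟨hi, h0⟩ := integral_shift_mul_sq_eq_zero hf h fun β => hmin β f g h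
  have hformula := fun s hs => two_mul_integral_shift_mul_sq_eq hf (h.congr_deriv hgG) hfG hG hi h0
    (t := s) hs
  set F : ℝ → ℝ := fun t => 2 * ∫ η in (0 : ℝ)..t, (η + α) * f η ^ 2 with hF
  have hFd : ∀ t, HasDerivAt F (2 * ((t + α) * f t ^ 2)) t := fun t =>
    ((show Continuous fun η => (η + α) * f η ^ 2 by fun_prop).integral_hasStrictDerivAt
      0 t).hasDerivAt.const_mul 2
  have hKF : ∀ t, costK0 f α t = f t ^ 2 + F t := fun t => rfl
  have hlim : Tendsto F atTop (𝓝 0) := by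
    have := (intervalIntegral_tendsto_integral_Ioi 0 hi tendsto_id).const_mul 2
    unfold halfLine at h0
    rw [h0, mul_zero] at this
    exact this
  have hKc : Continuous (costK0 f α) :=
    (hf.pow 2).add (continuous_iff_continuousAt.2 fun t => (hFd t).continuousAt)
  by_contra! hneg
  -- `F T` exceeds the negative value at `t`, hence so does `K T ≥ F T`, and the minimum over `[0,
  -- T]` is not at `T`.
  obtain ⟨T, hT, htT⟩ :=
    ((hlim.eventually (lt_mem_nhds hneg)).and (eventually_ge_atTop t)).exists
  obtain ⟨s, hs, hsmin⟩ := isCompact_Icc.exists_isMinOn ⟨t, ht, htT⟩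
    (hKc.continuousOn (s := Icc 0 T))
  have hst : costK0 f α s ≤ costK0 f α t := hsmin ⟨ht, htT⟩
  have hs0 : 0 < s := by
    refine lt_of_le_of_ne hs.1 fun he => ?_
    rw [← he, hKF 0] at hst
    have : F 0 = 0 := by simp [hF]
    nlinarith [sq_nonneg (f 0)]
  have hsT : s < T := by
    refine lt_of_le_of_ne hs.2 fun he => ?_
    rw [he, hKF T] at hst
    nlinarith [sq_nonneg (f T)]
  have hK' : HasDerivAt (costK0 f α) (2 * f s * (G s + (s + α) * f s)) s := by
    have := ((hfG s hs0).pow 2).add (hFd s)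
    refine this.congr_deriv ?_
    norm_num
    ring
  have hcrit := (hsmin.isLocalMin (Icc_mem_nhds hs0 hsT)).hasDerivAt_eq_zero hK'
  have hGsq : G s ^ 2 = (s + α) ^ 2 * f s ^ 2 := by
    rcases mul_eq_zero.1 hcrit with hfs | hGs
    · have hfs : f s = 0 := by linarith
      have hG0 : G s = 0 := by
        refine IsLocalMin.hasDerivAt_eq_zero (Eventually.of_forall fun x => ?_) (hfG s hs0)
        rw [hfs]
        exact hpos x
      rw [hG0, hfs]
      ring
    · rw [eq_neg_of_add_eq_zero_left hGs]
      ring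
  have hval : costK0 f α s = (1 - 1 / b) * f s ^ 2 + 1 / (2 * b) * f s ^ 4 := by
    have hFs : F s = _ := hformula s hs0
    rw [hKF, hFs, hGsq]
    ring
  have hb' : 1 / b ≤ 1 := by
    rw [div_le_one (by linarith)]
    exact hb
  have : 0 ≤ costK0 f α s := by
    rw [hval]
    have : 0 ≤ 1 - 1 / b := by linarith
    positivity
  linarith

end HalfLineGL

theorem proposition3p1 (b : ℝ) (hb : 1 ≤ b) (hbΘ : b < HalfLineGL.theta0⁻¹)
    (f₀ : ℝ → ℝ) (α₀ : ℝ) (hmin : HalfLineGL.IsMinimizingPair b f₀ α₀) :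
    ∀ t : ℝ, 0 ≤ t → 0 ≤ HalfLineGL.costK0 f₀ α₀ t := by
  intro t ht
  obtain ⟨h, g, hc, hpos, heq, hfin, hle⟩ := hmin.exists_nonneg
  have key := HalfLineGL.costK0_nonneg_of_nonneg hb hc hpos hfin hle ht
  have hcost : HalfLineGL.costK0 h α₀ t = HalfLineGL.costK0 f₀ α₀ t := by
    -- Only squares of values on `[0, t]` enter, where `h = |f₀|`.
    unfold HalfLineGL.costK0
    rw [heq t ht, sq_abs]
    congr 2
    refine intervalIntegral.integral_congr fun η hη => ?_
    rw [uIcc_of_le ht] at hη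
    simp only [heq η hη.1, sq_abs]
  rwa [hcost] at key
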